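/- All groups are Abelian and all topological groups are Hausdorff. A topological group is pseudocompact if every continuous real-valued function on it is bounded. $\mathbb Z(2)$ is the discrete two-element group, and $\mathbb Z(2)^{2^\kappa}$ is the product of $2^\kappa$ copies of it. For a topological group $H$, $H^\wedge$ denotes the group of continuous homomorphisms from $H$ to the circle group $\mathbb T$, with the compact-open topology. For an abstract Abelian group $A$, $A^\#$ denotes $A$ with its Bohr topology, that is, the coarsest topology for which all homomorphisms $A\to\mathbb T$ are continuous (equivalently, the finest precompact group topology on $A$). Let $\kappa\ge\omega$ be a cardinal and let $L$ be a dense pseudocompact subgroup of $\mathbb Z(2)^{2^\kappa}$ with $|L|\le 2^\kappa$. Suppose that $L^\wedge$ is discrete and that $L$ satisfies the following condition $(Sm)$: for every countable set $N\subseteq L$ there is a set $A_N\subseteq 2^\kappa$ with $|A_N|=2^\kappa$ such that $x_\alpha=e$ for all $x\in N$ and all $\alpha\in A_N$. Then there exists a pseudocompact group $G$ containing $L$ as a closed topological subgroup such that $G/L$ is compact and there is a topological isomorphism $$G^\wedge\cong\bigl(\mathbb Z(2)^{(\kappa)}\bigr)^\#\times L^\wedge ,$$ where $\mathbb Z(2)^{(\kappa)}$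 is the direct sum of $\kappa$ copies of $\mathbb Z(2)$. -/

import Mathlib

universe u

/-- A space is pseudocompact if every continuous real-valued function on it is bounded.
(The separation axiom that usually comes with the notion is stated separately.) -/
def IsPseudocompact (X : Type*) [TopologicalSpace X] : Prop :=
  ∀ f : X → ℝ, Continuous f → ∃ C : ℝ, ∀ x, |f x| ≤ C

/-- The two-element group `ℤ(2)`, written multiplicatively, with its discrete topology. -/
abbrev Z2 : Type := Multiplicative (ZMod 2)

/-- `A` with its Bohr topology: a type synonym for the abelian group `A` that carries the
coarsest topology making all homomorphisms from `A` to the circle group continuous. -/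
def Bohr (A : Type*) : Type _ := A

instance {A : Type*} [CommGroup A] : CommGroup (Bohr A) := inferInstanceAs (CommGroup A)

noncomputable instance {A : Type*} [CommGroup A] : TopologicalSpace (Bohr A) :=
  ⨅ χ : A →* Circle, TopologicalSpace.induced χ inferInstance

instance {A : Type*} [CommGroup A] : IsTopologicalGroup (Bohr A) :=
  topologicalGroup_iInf fun χ : Bohr A →* Circle => topologicalGroup_induced χ

/-- Condition (Sm) for a subgroup `L` of `ℤ(2)^I`, where `I` has cardinality `2 ^ κ`: for every
countable `N ⊆ L` there is a set `A ⊆ I` of `2 ^ κ` coordinates on which all elements of `N`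
are trivial. -/
def ConditionSm (κ : Cardinal.{u}) {I : Type u} (L : Subgroup (I → Z2)) : Prop :=
  ∀ N : Set (I → Z2), N ⊆ L → N.Countable →
    ∃ A : Set I, Cardinal.mk A = 2 ^ κ ∧ ∀ x ∈ N, ∀ a ∈ A, x a = 1

open Set Filter Topology Cardinal

/-! `G` consists of the pairs (c, l · h c) in Z(2)^J × Z(2)^I with l ∈ L, for a highly discontinuous
homomorphism h. Since L realizes every pattern on countably many coordinates, so does `G`, which
gives pseudocompactness; projection to Z(2)^J is open with kernel L, so `G`/L is compact.

Continuous characters of such groups are pairings with finitely supported vectors, so the dual of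
`G` splits algebraically into a J-part and the dual of L. `exists_wild_hom` makes compact subsets of
`G` finite modulo L (`finite_image_inl_of_isCompact`). On the J-part the compact-open topology is
therefore pointwise convergence on Z(2)^J, and this is the Bohr topology because every character of
Z(2)^(J) is pairing with a point of Z(2)^J. Discreteness of the dual of L makes the splitting
topological. -/

/-! ### Distinct representatives and linear algebra over finite fields. -/

/-- Recursion along a well-order of type `(#S).ord`: proper initial segments are smaller than `#S`,
so the values already used cannot exhaust `A x`. -/
theorem exists_injective_choice {S I : Type u} (A : S → Set I) (hA : ∀ s, #S ≤ #(A s)) :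
    ∃ f : S → I, Function.Injective f ∧ ∀ s, f s ∈ A s := by
  obtain ⟨r, wo, hr⟩ := Cardinal.exists_ord_eq S
  have hex : ∀ (x : S) (ih : ∀ y, r y x → I),
      ∃ i ∈ A x, ∀ (y : S) (hy : r y x), ih y hy ≠ i := by
    intro x ih
    by_contra! hcon
    have hsub : A x ⊆ range fun y : {y // r y x} => ih y y.2 := by
      intro i hi
      obtain ⟨y, hy, h⟩ := hcon i hi
      exact ⟨⟨y, hy⟩, h⟩
    have h1 : #(A x) ≤ #{y // r y x} := (mk_le_mk_of_subset hsub).trans mk_range_le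
    have h2 : #{y // r y x} < #S := by
      simpa using Cardinal.card_typein_lt x hr
    exact absurd ((hA x).trans h1) (not_le.2 h2)
  choose F hFA hFne using hex
  have hwf : WellFounded r := wo.wf
  have heq : ∀ x, hwf.fix F x = F x fun y _ => hwf.fix F y := fun x => hwf.fix_eq F x
  have hne : ∀ x y, r y x → hwf.fix F y ≠ hwf.fix F x := by
    intro x y h
    rw [heq x]
    exact hFne x (fun y _ => hwf.fix F y) y h
  refine ⟨hwf.fix F, fun x y hxy => ?_, fun s => ?_⟩
  · rcases trichotomous_of r x y with h | h | h
    · exact absurd hxy (hne y x h)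
    · exact h
    · exact absurd hxy.symm (hne x y h)
  · rw [heq s]
    exact hFA _ _

/-- Translating a linearly independent sequence by a fixed vector keeps some tail of it linearly
independent. -/
theorem LinearIndependent.exists_tail_sub {K V : Type*} [Field K] [AddCommGroup V] [Module K V]
    {u : ℕ → V} (hu : LinearIndependent K u) (c : V) :
    ∃ m, LinearIndependent K fun n => u (n + m) - c := by
  -- If `c` is a combination of the `u n`, take `m` beyond the indices involved; otherwise `m = 0`
  -- works.
  obtain ⟨m, hm⟩ : ∃ m, ∀ r : K, r • c ∈ Submodule.span K (u '' Ici m) → r • c = 0 := by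
    by_cases hc : c ∈ Submodule.span K (range u)
    · obtain ⟨l, hl⟩ := (Finsupp.mem_span_range_iff_exists_finsupp (R := K)).1 hc
      obtain ⟨m, hm⟩ := l.support.exists_nat_subset_range
      refine ⟨m, fun r hr => ?_⟩
      have hd := hu.disjoint_span_image (s := Ici m) (t := Iio m)
        (Set.disjoint_left.2 fun x (h1 : m ≤ x) (h2 : x < m) => not_lt.2 h1 h2)
      refine Submodule.disjoint_def.1 hd _ hr (Submodule.smul_mem _ _ ?_)
      rw [← hl]
      refine Submodule.sum_mem _ fun i hi => Submodule.smul_mem _ _ (Submodule.subset_span ?_)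
      exact ⟨i, by simpa using hm hi, rfl⟩
    · refine ⟨0, fun r hr => ?_⟩
      by_cases h0 : r = 0
      · simp [h0]
      · refine absurd ?_ hc
        rw [Submodule.smul_mem_iff _ h0] at hr
        exact Submodule.span_mono (image_subset_range _ _) hr
  refine ⟨m, ?_⟩
  have hu' : LinearIndependent K fun n => u (n + m) :=
    hu.comp (fun n => n + m) fun a b h => by simpa using h
  rw [linearIndependent_iff'] at hu' ⊢
  intro s g hg
  refine hu' s g ?_
  simp only [smul_sub, Finset.sum_sub_distrib, ← Finset.sum_smul] at hg
  rw [sub_eq_zero] at hg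
  rw [hg]
  refine hm _ ?_
  rw [← hg]
  exact Submodule.sum_mem _ fun i _ => Submodule.smul_mem _ _
    (Submodule.subset_span ⟨i + m, by simp, rfl⟩)

theorem LinearIndependent.exists_linearMap_eq_one {K V ι : Type*} [Field K] [AddCommGroup V]
    [Module K V] {v : ι → V} (hv : LinearIndependent K v) :
    ∃ φ : V →ₗ[K] K, ∀ i, φ (v i) = 1 := by
  obtain ⟨φ, hφ⟩ := ((Module.Basis.span hv).constr K fun _ => (1 : K)).exists_extend
  refine ⟨φ, fun i => ?_⟩
  have h := LinearMap.congr_fun hφ (Module.Basis.span hv i)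
  rw [Module.Basis.constr_basis] at h
  simpa [Module.Basis.span_apply] using h

/-- Over a finite field a finite-dimensional span is finite, so a maximal independent subset of an
infinite set is infinite. -/
theorem Set.Infinite.exists_linearIndependent_seq {K V : Type*} [Field K] [Finite K]
    [AddCommGroup V] [Module K V] {s : Set V} (hs : s.Infinite) :
    ∃ u : ℕ → V, LinearIndependent K u ∧ ∀ n, u n ∈ s := by
  obtain ⟨b, hbs, hspan, hb⟩ := exists_linearIndependent K s
  have hbinf : b.Infinite := by
    intro hfin
    have : Module.Finite K (Submodule.span K b) := Module.Finite.span_of_finite K hfin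
    have : Finite (Submodule.span K b) := Module.finite_of_finite K
    refine hs ((Set.toFinite (Submodule.span K b : Set V)).subset ?_)
    rw [hspan]
    exact Submodule.subset_span
  have := hbinf.to_subtype
  let e := _root_.Infinite.natEmbedding b
  exact ⟨fun n => e n, hb.comp e e.injective, fun n => hbs (e n).2⟩

/-! ### The wild homomorphism. -/

/-- The coordinates of an element of `ℤ(2)^X`, as a vector over the two-element field. -/
def toVec {X : Type*} : (X → Z2) →* Multiplicative (X → ZMod 2) where
  toFun x := Multiplicative.ofAdd fun i => (x i).toAdd
  map_one' := rfl
  map_mul' _ _ := rfl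

/-- Under `(Sm)` there is a homomorphism into `ℤ(2)^I` which is so wild that no sequence with
linearly independent differences converges along its graph modulo `L`. -/
theorem exists_wild_hom {κ : Cardinal.{u}} (hκ : ℵ₀ ≤ κ) {J : Type u} (hJ : #J = κ)
    {I : Type u} {L : Subgroup (I → Z2)} (hLcard : #L ≤ 2 ^ κ) (hLSm : ConditionSm κ L) :
    ∃ h : (J → Z2) →* (I → Z2), ∀ s : ℕ → (J → Z2) × L,
      LinearIndependent (ZMod 2)
        (fun n => (toVec (s (n + 1)).1).toAdd - (toVec (s 0).1).toAdd) →
      ∃ i, (∀ n, ((s n).2 : I → Z2) i = 1) ∧ ∀ n, h (s (n + 1)).1 i ≠ h (s 0).1 i := by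
  classical
  let S := ℕ → (J → Z2) × L
  have hinf : ℵ₀ ≤ (2 : Cardinal.{u}) ^ κ := hκ.trans (cantor κ).le
  have hJc : #(J → Z2) ≤ 2 ^ κ := by
    have : #Z2 = 2 := by simp [Z2, Cardinal.mk_fintype]
    rw [mk_pi, prod_const, this, hJ]
    simp
  -- There are only (2^κ)^ℵ₀ = 2^κ sequences, so each can receive a coordinate of its own.
  have hS : #S ≤ 2 ^ κ := by
    have h1 : #S = #((J → Z2) × L) ^ ℵ₀ := by simp [S]
    have h2 : #((J → Z2) × L) ≤ 2 ^ κ := by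
      rw [mk_prod, lift_id, lift_id]
      exact (mul_le_mul' hJc hLcard).trans (mul_eq_self hinf).le
    rw [h1]
    refine (power_le_power_right h2).trans ?_
    rw [← power_mul, mul_eq_left hκ hκ aleph0_ne_zero]
  have hA : ∀ s : S, ∃ A : Set I, #A = 2 ^ κ ∧ ∀ n, ∀ a ∈ A, ((s n).2 : I → Z2) a = 1 := by
    intro s
    obtain ⟨A, hA, h⟩ := hLSm (range fun n => ((s n).2 : I → Z2))
      (by rintro _ ⟨n, rfl⟩; exact (s n).2.2) (countable_range _)
    exact ⟨A, hA, fun n a ha => h _ ⟨n, rfl⟩ a ha⟩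
  choose A hAc hA1 using hA
  obtain ⟨α, hαinj, hαA⟩ := exists_injective_choice A fun s => hS.trans (hAc s).ge
  have hφ : ∀ s : S, ∃ φ : (J → ZMod 2) →ₗ[ZMod 2] ZMod 2,
      LinearIndependent (ZMod 2)
        (fun n => (toVec (s (n + 1)).1).toAdd - (toVec (s 0).1).toAdd) →
      ∀ n, φ ((toVec (s (n + 1)).1).toAdd - (toVec (s 0).1).toAdd) = 1 := by
    intro s
    by_cases hs : LinearIndependent (ZMod 2)
        (fun n => (toVec (s (n + 1)).1).toAdd - (toVec (s 0).1).toAdd)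
    · obtain ⟨φ, h⟩ := hs.exists_linearMap_eq_one
      exact ⟨φ, fun _ => h⟩
    · exact ⟨0, fun h => absurd h hs⟩
  choose φ hφ using hφ
  -- Coordinate `α s` of `h` is the functional `φ s`; coordinates assigned to no sequence get 0.
  let ψ : I → ((J → ZMod 2) →ₗ[ZMod 2] ZMod 2) := Function.extend α φ 0
  have hψ : ∀ s, ψ (α s) = φ s := fun s => hαinj.extend_apply φ 0 s
  let h : (J → Z2) →* (I → Z2) :=
    MonoidHom.mk' (fun x i => Multiplicative.ofAdd (ψ i (toVec x).toAdd))
      (fun x y => by funext i; simp [map_mul])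
  refine ⟨h, fun s hs => ⟨α s, fun n => hA1 s n _ (hαA s), fun n heq => ?_⟩⟩
  have h1 : φ s ((toVec (s (n + 1)).1).toAdd) = φ s ((toVec (s 0).1).toAdd) := by
    simpa [h, hψ] using heq
  have h2 := hφ s hs n
  rw [map_sub, h1, sub_self] at h2
  exact zero_ne_one h2

/-! ### Countable density and pseudocompactness. -/

/-- A set of functions is countably dense if it realizes every pattern on countably many
coordinates. -/
def CountablyDense {X Y : Type*} (D : Set (X → Y)) : Prop :=
  ∀ S : Set X, S.Countable → ∀ p : X → Y, ∃ d ∈ D, ∀ i ∈ S, d i = p i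

/-- If `D` misses a pattern on a countable `S`, the inverse distance to it in the metrizable power
`S → Y` is continuous on `D`, and unbounded by density. -/
theorem CountablyDense.of_isPseudocompact {X Y : Type*} [TopologicalSpace Y] [T3Space Y]
    [SecondCountableTopology Y] {D : Set (X → Y)} (hD : Dense D) (hp : IsPseudocompact D) :
    CountablyDense D := by
  intro S hS p
  by_contra! hcon
  have : Countable S := hS.to_subtype
  let _ : MetricSpace (S → Y) := TopologicalSpace.metrizableSpaceMetric (S → Y)
  let r : (X → Y) → (S → Y) := fun x i => x i
  have hr : Continuous r := by fun_prop
  have hpos : ∀ x ∈ D, 0 < dist (r x) (r p) := by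
    intro x hx
    rw [dist_pos]
    intro h
    obtain ⟨i, hi, hne⟩ := hcon x hx
    exact hne (congrFun h ⟨i, hi⟩)
  obtain ⟨C, hC⟩ := hp (fun x => (dist (r x) (r p))⁻¹)
    (Continuous.inv₀ (by fun_prop) fun x => (hpos x x.2).ne')
  have hopen : IsOpen {x | dist (r x) (r p) < (|C| + 1)⁻¹} :=
    isOpen_lt (by fun_prop) continuous_const
  obtain ⟨x, hxU, hx⟩ := hD.inter_open_nonempty _ hopen ⟨p, by
    change dist (r p) (r p) < _
    rw [dist_self]
    positivity⟩
  have h1 := (le_abs_self _).trans (hC ⟨x, hx⟩)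
  have h2 : |C| + 1 < (dist (r x) (r p))⁻¹ :=
    (lt_inv_comm₀ (hpos x hx) (by positivity)).1 hxU
  have := le_abs_self C
  have h3 : (dist (r x) (r p))⁻¹ ≤ C := h1
  linarith

theorem isOpen_setOf_eqOn {X Y : Type*} [TopologicalSpace Y] [DiscreteTopology Y] {F : Set X}
    (hF : F.Finite) (p : X → Y) : IsOpen {x : X → Y | ∀ i ∈ F, x i = p i} := by
  have : {x : X → Y | ∀ i ∈ F, x i = p i} = F.pi fun i => {p i} := by
    ext x; simp [Set.mem_pi]
  rw [this]
  exact isOpen_set_pi hF fun i _ => isOpen_discrete _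

theorem exists_finite_eqOn_subset {X Y : Type*} [TopologicalSpace Y] [DiscreteTopology Y]
    {U : Set (X → Y)} (hU : IsOpen U) {p : X → Y} (hp : p ∈ U) :
    ∃ F : Finset X, ∀ x : X → Y, (∀ i ∈ F, x i = p i) → x ∈ U := by
  obtain ⟨F, u, hu, hsub⟩ := isOpen_pi_iff.1 hU p hp
  exact ⟨F, fun x hx => hsub fun i hi => by rw [hx i hi]; exact (hu i hi).2⟩

/-- Near each point, `f` is controlled up to 1 by finitely many coordinates. If |f(x n)| > n, let
`p` be a cluster point of the `x n` and `g ∈ D` agree with `p` on all coordinates controlling them.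
A point interpolating between `x n` and `g` then bounds |f(x n)| by |f(g)| + 2. -/
theorem CountablyDense.isPseudocompact {X Y : Type*} [TopologicalSpace Y] [DiscreteTopology Y]
    [CompactSpace Y] {D : Set (X → Y)} (hD : CountablyDense D) : IsPseudocompact D := by
  classical
  intro f hf
  by_contra! hcon
  choose x hx using fun n : ℕ => hcon n
  have hnear : ∀ d : D, ∃ F : Finset X, ∀ y : D,
      (∀ i ∈ F, (y : X → Y) i = (d : X → Y) i) → |f y - f d| < 1 := by
    intro d
    have ho : IsOpen {y : D | |f y - f d| < 1} := isOpen_lt (by fun_prop) continuous_const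
    obtain ⟨U, hU, hUeq⟩ := isOpen_induced_iff.1 ho
    have hdU : (d : X → Y) ∈ U := by
      have : d ∈ Subtype.val ⁻¹' U := by rw [hUeq]; simp
      exact this
    obtain ⟨F, hF⟩ := exists_finite_eqOn_subset hU hdU
    refine ⟨F, fun y hy => ?_⟩
    have : y ∈ Subtype.val ⁻¹' U := hF y hy
    rw [hUeq] at this
    exact this
  choose F hF using hnear
  obtain ⟨p, hp⟩ : ∃ p : X → Y, MapClusterPt p atTop fun n => (x n : X → Y) := by
    obtain ⟨p, -, hp⟩ := isCompact_univ.exists_mapClusterPt (u := fun n => (x n : X → Y))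
      (f := atTop) (by simp)
    exact ⟨p, hp⟩
  obtain ⟨g, hgD, hg⟩ := hD (⋃ n, (F (x n) : Set X))
    (countable_iUnion fun n => (F (x n)).countable_toSet) p
  let G : D := ⟨g, hgD⟩
  have hfreq := hp.frequently ((isOpen_setOf_eqOn (F G).finite_toSet p).mem_nhds fun _ _ => rfl)
  obtain ⟨N, hN⟩ := exists_nat_gt (|f G| + 2)
  obtain ⟨n, hnN, hn⟩ := frequently_atTop.1 hfreq N
  -- The two prescriptions agree on the overlap: there `x n` equals `p` by the choice of `n`, and
  -- `g` equals `p` by the choice of `g`.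
  obtain ⟨y, hyD, hy⟩ := hD (F (x n) ∪ F G) ((F (x n)).countable_toSet.union (F G).countable_toSet)
    fun i => if i ∈ F (x n) then (x n : X → Y) i else g i
  have h1 := hF (x n) ⟨y, hyD⟩ fun i hi => by
    have := hy i (Or.inl hi)
    rwa [if_pos hi] at this
  have h2 := hF G ⟨y, hyD⟩ fun i hi => by
    have := hy i (Or.inr hi)
    dsimp only
    rw [this]
    split_ifs with h
    · rw [hn i hi]
      exact (hg i (mem_iUnion.2 ⟨n, h⟩)).symm
    · rfl
  have h3 : (N : ℝ) ≤ n := by exact_mod_cast hnN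
  have h4 := hx n
  have h5 : |f (x n)| ≤ |f ⟨y, hyD⟩ - f (x n)| + |f ⟨y, hyD⟩ - f G| + |f G| := by
    have e : f (x n) = -(f ⟨y, hyD⟩ - f (x n)) + (f ⟨y, hyD⟩ - f G) + f G := by ring
    calc |f (x n)| = |-(f ⟨y, hyD⟩ - f (x n)) + (f ⟨y, hyD⟩ - f G) + f G| := by rw [← e]
      _ ≤ _ := (abs_add_three _ _ _).trans (by rw [abs_neg])
  linarith

/-! ### Characters of subgroups of Z(2)^X. -/

theorem exists_toCircle_eq_of_mul_self {z : Circle} (hz : z * z = 1) :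
    ∃ r : ZMod 2, ZMod.toCircle r = z := by
  have hcases : ∀ w : Circle, w * w = 1 → w = 1 ∨ (w : ℂ) = -1 := by
    intro w hw
    have h : (w : ℂ) * w = 1 := by
      rw [← Circle.coe_mul, hw, Circle.coe_one]
    rcases mul_self_eq_one_iff.1 h with h | h
    · exact Or.inl (Circle.ext (by simpa using h))
    · exact Or.inr h
  have h0 : ZMod.toCircle (0 : ZMod 2) = 1 := AddChar.map_zero_eq_one _
  have h1 : (ZMod.toCircle (1 : ZMod 2) : ℂ) = -1 := by
    refine (hcases _ ?_).resolve_left fun h => ?_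
    · rw [← AddChar.map_add_eq_mul, show (1 : ZMod 2) + 1 = 0 from rfl, h0]
    · exact one_ne_zero (ZMod.injective_toCircle (h.trans h0.symm))
  rcases hcases z hz with h | h
  · exact ⟨0, h0.trans h.symm⟩
  · exact ⟨1, Circle.ext (h1.trans h.symm)⟩

theorem Z2.mul_self (z : Z2) : z * z = 1 := by
  revert z; decide

theorem PontryaginDual.exists_toCircle_eq {X : Type*} {D : Subgroup (X → Z2)}
    (χ : PontryaginDual D) (d : D) : ∃ r : ZMod 2, ZMod.toCircle r = χ d := by
  refine exists_toCircle_eq_of_mul_self ?_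
  have hd : d * d = 1 := Subtype.ext (funext fun i => Z2.mul_self _)
  rw [← _root_.map_mul, hd, _root_.map_one]

/-- The duality pairing between `ℤ(2)^X` and the finitely supported vectors. -/
noncomputable def pairing {X : Type*} (x : X → Z2) (a : X →₀ ZMod 2) : ZMod 2 :=
  Finsupp.linearCombination (ZMod 2) (toVec x).toAdd a

section pairing

variable {X : Type*}

theorem pairing_eq_sum (x : X → Z2) (a : X →₀ ZMod 2) :
    pairing x a = a.sum fun i r => r * (x i).toAdd := by
  simp [pairing, Finsupp.linearCombination_apply, toVec]

@[simp] theorem pairing_one (a : X →₀ ZMod 2) : pairing (1 : X → Z2) a = 0 := by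
  simp [pairing_eq_sum]

@[simp] theorem pairing_zero (x : X → Z2) : pairing x 0 = 0 := by
  simp [pairing]

theorem pairing_mul (x y : X → Z2) (a : X →₀ ZMod 2) :
    pairing (x * y) a = pairing x a + pairing y a := by
  simp [pairing_eq_sum, mul_add, Finsupp.sum_add]

theorem pairing_add (x : X → Z2) (a b : X →₀ ZMod 2) :
    pairing x (a + b) = pairing x a + pairing x b := by
  simp [pairing]

theorem continuous_pairing (a : X →₀ ZMod 2) : Continuous fun x : X → Z2 => pairing x a := by
  simp only [pairing_eq_sum, Finsupp.sum]
  refine continuous_finsetSum _ fun i _ => ?_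
  exact (continuous_of_discreteTopology (f := fun z : Z2 => a i * z.toAdd)).comp
    (continuous_apply i)

theorem pairing_sum {Y : Type*} (x : X ⊕ Y → Z2) (a : X →₀ ZMod 2) (b : Y →₀ ZMod 2) :
    pairing x (Finsupp.sumFinsuppAddEquivProdFinsupp.symm (a, b)) =
      pairing (x ∘ Sum.inl) a + pairing (x ∘ Sum.inr) b := by
  have : Finsupp.sumFinsuppAddEquivProdFinsupp.symm (a, b) =
      a.mapDomain (Sum.inl : X → X ⊕ Y) + b.mapDomain Sum.inr := by
    ext (i | i)
    · simp [Finsupp.sumFinsuppAddEquivProdFinsupp, Finsupp.mapDomain_apply Sum.inl_injective,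
        Finsupp.mapDomain_of_notMem_range]
    · simp [Finsupp.sumFinsuppAddEquivProdFinsupp, Finsupp.mapDomain_apply Sum.inr_injective,
        Finsupp.mapDomain_of_notMem_range]
  rw [this, pairing_add]
  simp only [pairing, Finsupp.linearCombination_mapDomain]
  rfl

/-- Every homomorphism from the finitely supported vectors to the circle is a pairing. -/
theorem exists_toCircle_pairing (η : Multiplicative (X →₀ ZMod 2) →* Circle) :
    ∃ c : X → Z2, ∀ a, η a = ZMod.toCircle (pairing c a.toAdd) := by
  have hr : ∀ i, ∃ r : ZMod 2,
      ZMod.toCircle r = η (Multiplicative.ofAdd (Finsupp.single i 1)) := by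
    intro i
    refine exists_toCircle_eq_of_mul_self ?_
    rw [← map_mul, ← ofAdd_add, ← Finsupp.single_add, show (1 : ZMod 2) + 1 = 0 from rfl,
      Finsupp.single_zero, ofAdd_zero, map_one]
  choose r hr using hr
  let c : X → Z2 := fun i => Multiplicative.ofAdd (r i)
  let ζ : Multiplicative (X →₀ ZMod 2) →* Circle :=
    MonoidHom.mk' (fun a => ZMod.toCircle (pairing c a.toAdd)) fun a b => by
      rw [toAdd_mul, pairing_add, AddChar.map_add_eq_mul]
  refine ⟨c, fun a => DFunLike.congr_fun (g := ζ) (Finsupp.mulHom_ext fun i y => ?_) a⟩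
  have hy : ∀ y : ZMod 2, y = 0 ∨ y = 1 := by decide
  rcases hy y with rfl | rfl
  · simp
  · rw [← hr]
    simp [ζ, pairing_eq_sum, c]

/-- The continuous characters of a subgroup of `ℤ(2)^X` given by finitely supported vectors. -/
noncomputable def charOf (D : Subgroup (X → Z2)) :
    Multiplicative (X →₀ ZMod 2) →* PontryaginDual D where
  toFun a :=
    ({ toFun := fun x => ZMod.toCircle (pairing (x : X → Z2) a.toAdd)
       map_one' := by simp
       map_mul' := fun x y => by simp [pairing_mul, AddChar.map_add_eq_mul]
       continuous_toFun := continuous_of_discreteTopology.comp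
        ((continuous_pairing a.toAdd).comp continuous_subtype_val) } : D →ₜ* Circle)
  map_one' := PontryaginDual.ext fun x => by
    change ZMod.toCircle (pairing (x : X → Z2) 0) = 1
    simp
  map_mul' a b := PontryaginDual.ext fun x => by
    change ZMod.toCircle (pairing (x : X → Z2) (a.toAdd + b.toAdd)) =
      ZMod.toCircle (pairing (x : X → Z2) a.toAdd) * ZMod.toCircle (pairing (x : X → Z2) b.toAdd)
    rw [pairing_add, AddChar.map_add_eq_mul]

theorem charOf_apply (D : Subgroup (X → Z2)) (a : Multiplicative (X →₀ ZMod 2)) (x : D) :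
    charOf D a x = ZMod.toCircle (pairing (x : X → Z2) a.toAdd) := rfl

theorem charOf_injective {D : Subgroup (X → Z2)} (hD : CountablyDense (D : Set (X → Z2))) :
    Function.Injective (charOf D) := by
  classical
  refine (injective_iff_map_eq_one _).2 fun a ha => ?_
  suffices h : a.toAdd = 0 from h
  ext i
  obtain ⟨d, hdD, hd⟩ := hD (insert i (a.toAdd.support : Set X))
    ((Finset.countable_toSet _).insert i) (Pi.mulSingle i (Multiplicative.ofAdd 1))
  have h1 : charOf D a ⟨d, hdD⟩ = ZMod.toCircle (0 : ZMod 2) := by rw [ha]; simp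
  rw [charOf_apply] at h1
  have h2 := ZMod.injective_toCircle h1
  rw [pairing_eq_sum, Finsupp.sum, Finset.sum_eq_single i] at h2
  · simpa [hd i (mem_insert _ _)] using h2
  · intro j hj hji
    simp [hd j (mem_insert_of_mem _ hj), Pi.mulSingle_eq_of_ne hji]
  · intro hi
    simp [Finsupp.notMem_support_iff.1 hi]

/-- A character avoiding -1 near the identity is trivial on elements that vanish on some finite `F`.
It is thus determined by its values on elements of `D` imitating the unit vectors on `F`. -/
theorem charOf_surjective {D : Subgroup (X → Z2)} (hD : CountablyDense (D : Set (X → Z2))) :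
    Function.Surjective (charOf D) := by
  classical
  intro χ
  have ho : IsOpen {x : D | χ x ≠ ZMod.toCircle (1 : ZMod 2)} :=
    isOpen_ne.preimage (map_continuous χ)
  obtain ⟨U, hU, hUeq⟩ := isOpen_induced_iff.1 ho
  have h1U : ((1 : D) : X → Z2) ∈ U := by
    have : (1 : D) ∈ Subtype.val ⁻¹' U := by
      rw [hUeq]
      change χ 1 ≠ _
      rw [map_one, ← AddChar.map_zero_eq_one (ZMod.toCircle (N := 2))]
      exact fun h => zero_ne_one (ZMod.injective_toCircle h)
    exact this
  obtain ⟨F, hF⟩ := exists_finite_eqOn_subset hU h1U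
  have hker : ∀ y : D, (∀ i ∈ F, (y : X → Z2) i = 1) → χ y = 1 := by
    intro y hy
    have hyU : y ∈ Subtype.val ⁻¹' U := hF y hy
    rw [hUeq] at hyU
    obtain ⟨r, hr⟩ := χ.exists_toCircle_eq y
    have hcases : ∀ r : ZMod 2, r = 0 ∨ r = 1 := by decide
    rcases hcases r with rfl | rfl
    · rw [← hr, AddChar.map_zero_eq_one]
    · exact absurd hr.symm hyU
  have hd : ∀ i, ∃ d : D, ∀ j ∈ F, (d : X → Z2) j =
      (Pi.mulSingle i (Multiplicative.ofAdd 1) : X → Z2) j := by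
    intro i
    obtain ⟨d, hdD, hd⟩ := hD F F.countable_toSet (Pi.mulSingle i (Multiplicative.ofAdd 1))
    exact ⟨⟨d, hdD⟩, hd⟩
  choose d hd using hd
  choose r hr using fun i => χ.exists_toCircle_eq (d i)
  let a : X →₀ ZMod 2 := ∑ i ∈ F, Finsupp.single i (r i)
  have hpair : ∀ x : X → Z2, pairing x a = ∑ i ∈ F, r i * (x i).toAdd := by
    intro x
    simp only [a, pairing, map_sum, Finsupp.linearCombination_single]
    rfl
  refine ⟨Multiplicative.ofAdd a, PontryaginDual.ext fun x => ?_⟩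
  rw [charOf_apply, toAdd_ofAdd, hpair]
  -- `e` agrees with `x` on `F`, so `x * e` is trivial there.
  let e : D := ∏ i ∈ F, d i ^ ((x : X → Z2) i).toAdd.val
  have he : χ (x * e) = 1 := by
    refine hker _ fun j hj => ?_
    have hpow : ∀ z : Z2, (Multiplicative.ofAdd (1 : ZMod 2)) ^ z.toAdd.val = z := by decide
    have : (e : X → Z2) j = (x : X → Z2) j := by
      simp only [e, Subgroup.val_finsetProd, Finset.prod_apply, Subgroup.coe_pow, Pi.pow_apply]
      rw [Finset.prod_eq_single j]
      · rw [hd j j hj, Pi.mulSingle_eq_same, hpow]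
      · intro i _ hij
        rw [hd i j hj, Pi.mulSingle_eq_of_ne hij.symm, one_pow]
      · exact fun h => absurd hj h
    rw [Subgroup.coe_mul, Pi.mul_apply, this, Z2.mul_self]
  have he' : χ e = ZMod.toCircle (∑ i ∈ F, r i * ((x : X → Z2) i).toAdd) := by
    rw [map_prod, show ZMod.toCircle (∑ i ∈ F, r i * ((x : X → Z2) i).toAdd) =
      ∏ i ∈ F, ZMod.toCircle (r i * ((x : X → Z2) i).toAdd) from
        map_prod ZMod.toCircle.toMonoidHom
          (fun i => Multiplicative.ofAdd (r i * ((x : X → Z2) i).toAdd)) F]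
    refine Finset.prod_congr rfl fun i _ => ?_
    rw [map_pow, ← hr, ← AddChar.map_nsmul_eq_pow, nsmul_eq_mul, ZMod.natCast_val, ZMod.cast_id,
      mul_comm]
  have hee : χ e * χ e = 1 := by
    rw [← map_mul, show e * e = 1 from Subtype.ext (funext fun i => Z2.mul_self _), map_one]
  rw [map_mul] at he
  rw [← he']
  exact mul_right_cancel (hee.trans he.symm)

/-- The dual of a countably dense subgroup of `ℤ(2)^X`. -/
noncomputable def charEquiv {D : Subgroup (X → Z2)} (hD : CountablyDense (D : Set (X → Z2))) :
    Multiplicative (X →₀ ZMod 2) ≃* PontryaginDual D :=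
  MulEquiv.ofBijective (charOf D) ⟨charOf_injective hD, charOf_surjective hD⟩

end pairing

/-! ### The Bohr topology and the dual of the extension. -/

theorem continuous_bohr_rng {A Y : Type*} [CommGroup A] [TopologicalSpace Y] {f : Y → Bohr A}
    (hf : ∀ χ : A →* Circle, Continuous fun y => χ (f y)) : Continuous f :=
  continuous_iInf_rng.2 fun χ => continuous_induced_rng.2 (hf χ)

theorem Bohr.continuous_char {A : Type*} [CommGroup A] (χ : A →* Circle) :
    Continuous fun a : Bohr A => χ a :=
  continuous_iInf_dom (i := χ) continuous_induced_dom

/-- The dual of an extension of `L` whose compact subsets are finite modulo `L`. -/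
theorem nonempty_dual_continuousMulEquiv {J I : Type*} {L : Subgroup (I → Z2)}
    {G : Subgroup (J ⊕ I → Z2)} (hL : CountablyDense (L : Set (I → Z2)))
    (hG : CountablyDense (G : Set (J ⊕ I → Z2))) [DiscreteTopology (PontryaginDual L)]
    (ι : L →ₜ* G) (hι : ∀ l : L, (ι l : J ⊕ I → Z2) = Sum.elim (1 : J → Z2) l)
    (hsurj : ∀ c : J → Z2, ∃ g : G, (g : J ⊕ I → Z2) ∘ Sum.inl = c)
    (hfin : ∀ K : Set G, IsCompact K → ((fun g : G => (g : J ⊕ I → Z2) ∘ Sum.inl) '' K).Finite) :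
    Nonempty (PontryaginDual G ≃ₜ*
      (Bohr (Multiplicative (J →₀ ZMod 2)) × PontryaginDual L)) := by
  let Ψ : Bohr (Multiplicative (J →₀ ZMod 2)) × PontryaginDual L ≃* PontryaginDual G :=
    (MulEquiv.prodCongr (MulEquiv.refl (Multiplicative (J →₀ ZMod 2)))
      (charEquiv hL).symm).trans
      ((MulEquiv.prodMultiplicative (G := J →₀ ZMod 2) (H := I →₀ ZMod 2)).symm.trans
        ((AddEquiv.toMultiplicative Finsupp.sumFinsuppAddEquivProdFinsupp.symm).trans
          (charEquiv hG)))
  let θ : PontryaginDual L → (I → Z2) → Circle := fun χ x =>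
    ZMod.toCircle (pairing x ((charEquiv hL).symm χ).toAdd)
  let τ : Bohr (Multiplicative (J →₀ ZMod 2)) → (J → Z2) → Circle := fun a x =>
    ZMod.toCircle (pairing x (Multiplicative.toAdd (α := J →₀ ZMod 2) a))
  have hΨ : ∀ p g, Ψ p g = τ p.1 ((g : J ⊕ I → Z2) ∘ Sum.inl) *
      θ p.2 ((g : J ⊕ I → Z2) ∘ Sum.inr) := by
    rintro ⟨a, χ⟩ g
    change ZMod.toCircle (pairing (g : J ⊕ I → Z2)
      (Finsupp.sumFinsuppAddEquivProdFinsupp.symm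
        (Multiplicative.toAdd (α := J →₀ ZMod 2) a, ((charEquiv hL).symm χ).toAdd))) = _
    rw [pairing_sum, AddChar.map_add_eq_mul]
  have hτ1 : ∀ a, τ a 1 = 1 := fun a => by simp [τ]
  have hθ : ∀ χ (l : L), θ χ l = χ l := fun χ l =>
    DFunLike.congr_fun ((charEquiv hL).apply_symm_apply χ) l
  have hτcont : ∀ c, Continuous fun a => τ a c := by
    intro c
    exact Bohr.continuous_char (A := Multiplicative (J →₀ ZMod 2))
      (MonoidHom.mk' (fun a => ZMod.toCircle (pairing c a.toAdd)) fun a b => by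
        rw [toAdd_mul, pairing_add, AddChar.map_add_eq_mul])
  have hres : ∀ ξ, (Ψ.symm ξ).2 = PontryaginDual.map ι ξ := by
    intro ξ
    refine PontryaginDual.ext fun l => ?_
    conv_rhs => rw [← Ψ.apply_symm_apply ξ]
    rw [PontryaginDual.map_apply, hΨ, hι, Sum.elim_comp_inl, Sum.elim_comp_inr, hτ1, one_mul, hθ]
  have hres_cont : Continuous fun ξ : PontryaginDual G => PontryaginDual.map ι ξ :=
    map_continuous (PontryaginDual.map ι)
  have hinv : Continuous Ψ.symm := by
    refine Continuous.prodMk (f := fun ξ => (Ψ.symm ξ).1) (g := fun ξ => (Ψ.symm ξ).2) ?_ ?_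
    · refine continuous_bohr_rng fun η => ?_
      obtain ⟨c, hc⟩ := exists_toCircle_pairing η
      obtain ⟨g, rfl⟩ := hsurj c
      -- A character of the Bohr factor is evaluation at a point of `G`, up to a factor depending
      -- only on the restriction to `L`, which lives in a discrete group.
      have heq : (fun ξ : PontryaginDual G => η (Ψ.symm ξ).1) = fun ξ =>
          ξ g * (θ (PontryaginDual.map ι ξ) ((g : J ⊕ I → Z2) ∘ Sum.inr))⁻¹ := by
        funext ξ
        rw [eq_mul_inv_iff_mul_eq, ← hres]
        conv_rhs => rw [← Ψ.apply_symm_apply ξ]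
        rw [hΨ]
        exact congrArg (· * _) (hc (Ψ.symm ξ).1)
      rw [heq]
      refine Continuous.mul ?_ (Continuous.inv ?_)
      · exact ContinuousEvalConst.continuous_eval_const (F := G →ₜ* Circle) g
      · exact (continuous_of_discreteTopology
          (f := fun χ => θ χ ((g : J ⊕ I → Z2) ∘ Sum.inr))).comp hres_cont
    · simp only [hres]
      exact hres_cont
  have hfst : Continuous fun a : Bohr (Multiplicative (J →₀ ZMod 2)) => Ψ (a, 1) := by
    refine (ContinuousMonoidHom.isInducing_toContinuousMap G Circle).continuous_iff.2 ?_
    refine ContinuousMap.continuous_compactOpen.2 fun K hK U hU => ?_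
    -- On the J-part a subbasic compact-open condition sees only the image of `K` in Z(2)^J, hence
    -- is a finite set of pointwise conditions.
    have hset : {a : Bohr (Multiplicative (J →₀ ZMod 2)) | MapsTo (Ψ (a, 1)) K U} =
        ⋂ c ∈ (fun g : G => (g : J ⊕ I → Z2) ∘ Sum.inl) '' K, {a | τ a c ∈ U} := by
      ext a
      have h1 : ∀ g : G, Ψ (a, 1) g = τ a ((g : J ⊕ I → Z2) ∘ Sum.inl) := by
        intro g
        rw [hΨ]
        simp [θ]
      simp [MapsTo, h1]
    change IsOpen {a : Bohr (Multiplicative (J →₀ ZMod 2)) | MapsTo (Ψ (a, 1)) K U}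
    rw [hset]
    exact (hfin K hK).isOpen_biInter fun c _ => hU.preimage (hτcont c)
  have hcont : Continuous Ψ := by
    have heq : (Ψ : _ → PontryaginDual G) = fun p => Ψ (p.1, 1) * Ψ (1, p.2) := by
      funext p
      rw [← map_mul, Prod.mk_mul_mk, mul_one, one_mul]
    rw [heq]
    exact (hfst.comp continuous_fst).mul
      ((continuous_of_discreteTopology (f := fun χ => Ψ (1, χ))).comp continuous_snd)
  exact ⟨{ Ψ.symm with
    continuous_toFun := hinv
    continuous_invFun := hcont }⟩

/-! ### The group generated by `L` and the graph of `h`. -/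

section extension

variable {J I : Type*}

/-- The defect of a point of `ℤ(2)^(J ⊕ I)` from lying on the graph of `h`. -/
def graphDefect (h : (J → Z2) →* (I → Z2)) : (J ⊕ I → Z2) →* (I → Z2) where
  toFun x := (x ∘ Sum.inr) / h (x ∘ Sum.inl)
  map_one' := by
    have h1 : (1 : J ⊕ I → Z2) ∘ (Sum.inl : J → J ⊕ I) = 1 := rfl
    have h2 : (1 : J ⊕ I → Z2) ∘ (Sum.inr : I → J ⊕ I) = 1 := rfl
    rw [h1, h2, map_one, div_one]
  map_mul' x y := by
    have h1 : (x * y) ∘ (Sum.inl : J → J ⊕ I) = (x ∘ Sum.inl) * (y ∘ Sum.inl) := rfl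
    have h2 : (x * y) ∘ (Sum.inr : I → J ⊕ I) = (x ∘ Sum.inr) * (y ∘ Sum.inr) := rfl
    rw [h1, h2, map_mul, mul_div_mul_comm]

/-- The subgroup of `ℤ(2)^(J ⊕ I)` generated by `L` and the graph of `h`. -/
def graphExtension (h : (J → Z2) →* (I → Z2)) (L : Subgroup (I → Z2)) : Subgroup (J ⊕ I → Z2) :=
  L.comap (graphDefect h)

variable {h : (J → Z2) →* (I → Z2)} {L : Subgroup (I → Z2)}

theorem mem_graphExtension {x : J ⊕ I → Z2} :
    x ∈ graphExtension h L ↔ (x ∘ Sum.inr) / h (x ∘ Sum.inl) ∈ L := Iff.rfl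

theorem elim_mem_graphExtension (c : J → Z2) {l : I → Z2} (hl : l ∈ L) :
    Sum.elim c (l * h c) ∈ graphExtension h L := by
  rw [mem_graphExtension, Sum.elim_comp_inl, Sum.elim_comp_inr, mul_div_cancel_right]
  exact hl

/-- Beyond countable density, the whole J-part can be prescribed; this makes projection to Z(2)^J
open. -/
theorem exists_mem_graphExtension_eqOn (hL : CountablyDense (L : Set (I → Z2))) {S : Set (J ⊕ I)}
    (hS : S.Countable) (p : J ⊕ I → Z2) :
    ∃ g ∈ graphExtension h L, g ∘ Sum.inl = p ∘ Sum.inl ∧ ∀ i ∈ S, g i = p i := by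
  obtain ⟨l, hl, hlp⟩ := hL (Sum.inr ⁻¹' S) (hS.preimage Sum.inr_injective)
    ((p ∘ Sum.inr) / h (p ∘ Sum.inl))
  refine ⟨_, elim_mem_graphExtension (p ∘ Sum.inl) hl, Sum.elim_comp_inl _ _, ?_⟩
  rintro (i | i) hi
  · rfl
  · simp [hlp i hi]

theorem countablyDense_graphExtension (hL : CountablyDense (L : Set (I → Z2))) :
    CountablyDense (graphExtension h L : Set (J ⊕ I → Z2)) := fun S hS p => by
  obtain ⟨g, hg, -, hgp⟩ := exists_mem_graphExtension_eqOn (h := h) hL hS p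
  exact ⟨g, hg, hgp⟩

variable (h L) in
/-- The inclusion of `L` in the extension. -/
def graphExtensionIncl : L →* graphExtension h L where
  toFun l := ⟨Sum.elim 1 l, by
    simpa using elim_mem_graphExtension (h := h) 1 l.2⟩
  map_one' := Subtype.ext (Sum.elim_one_one)
  map_mul' x y := Subtype.ext (by ext (i | i) <;> simp)

theorem coe_graphExtensionIncl (l : L) :
    (graphExtensionIncl h L l : J ⊕ I → Z2) = Sum.elim (1 : J → Z2) l := rfl

theorem mem_range_graphExtensionIncl {g : graphExtension h L} :
    g ∈ (graphExtensionIncl h L).range ↔ (g : J ⊕ I → Z2) ∘ Sum.inl = 1 := by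
  constructor
  · rintro ⟨l, rfl⟩
    rfl
  · intro hg
    have hmem := mem_graphExtension.1 g.2
    rw [hg, map_one, div_one] at hmem
    refine ⟨⟨_, hmem⟩, Subtype.ext ?_⟩
    rw [coe_graphExtensionIncl]
    dsimp only
    rw [← hg, Sum.elim_comp_inl_inr]

theorem continuous_graphExtensionIncl : Continuous (graphExtensionIncl h L) := by
  refine Continuous.subtype_mk (continuous_pi ?_) _
  rintro (i | i)
  · exact continuous_const
  · exact (continuous_apply i).comp continuous_subtype_val

theorem continuous_graphExtension_inl :
    Continuous fun g : graphExtension h L => (g : J ⊕ I → Z2) ∘ Sum.inl :=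
  (continuous_pi fun j => continuous_apply (Sum.inl j)).comp continuous_subtype_val

theorem isClosedEmbedding_graphExtensionIncl : IsClosedEmbedding (graphExtensionIncl h L) := by
  refine ⟨IsEmbedding.of_comp continuous_graphExtensionIncl
    (g := fun g : graphExtension h L => (g : J ⊕ I → Z2) ∘ Sum.inr)
    ((continuous_pi fun i => continuous_apply (Sum.inr i)).comp continuous_subtype_val)
    IsEmbedding.subtypeVal, ?_⟩
  have : range (graphExtensionIncl h L) =
      (fun g : graphExtension h L => (g : J ⊕ I → Z2) ∘ Sum.inl) ⁻¹' {1} := by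
    ext g
    exact mem_range_graphExtensionIncl
  rw [this]
  exact isClosed_singleton.preimage continuous_graphExtension_inl

theorem isOpenMap_graphExtension_inl (hL : CountablyDense (L : Set (I → Z2))) :
    IsOpenMap fun g : graphExtension h L => (g : J ⊕ I → Z2) ∘ Sum.inl := by
  intro U hU
  rw [isOpen_iff_mem_nhds]
  rintro _ ⟨g, hgU, rfl⟩
  obtain ⟨V, hV, rfl⟩ := isOpen_induced_iff.1 hU
  obtain ⟨F, hF⟩ := exists_finite_eqOn_subset hV hgU
  refine mem_of_superset ((isOpen_setOf_eqOn (F.finite_toSet.preimage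
    Sum.inl_injective.injOn) ((g : J ⊕ I → Z2) ∘ Sum.inl)).mem_nhds fun _ _ => rfl) ?_
  intro c hc
  obtain ⟨x, hx, hxc, hxF⟩ := exists_mem_graphExtension_eqOn (h := h) hL F.countable_toSet
    (Sum.elim c ((g : J ⊕ I → Z2) ∘ Sum.inr))
  refine ⟨⟨x, hx⟩, hF x ?_, hxc⟩
  rintro (i | i) hi
  · rw [hxF _ hi]
    exact hc i hi
  · exact hxF _ hi

/-- The section `c ↦ (c, h c)` need not be continuous, but it is modulo `L`, so the quotient is a
continuous image of the compact group Z(2)^J. -/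
theorem compactSpace_quotient_graphExtension (hL : CountablyDense (L : Set (I → Z2))) :
    CompactSpace (graphExtension h L ⧸ (graphExtensionIncl h L).range) := by
  let sec : (J → Z2) → graphExtension h L := fun c =>
    ⟨Sum.elim c (1 * h c), elim_mem_graphExtension c L.one_mem⟩
  have hq := (isOpenMap_graphExtension_inl (h := h) hL).isQuotientMap
    continuous_graphExtension_inl fun c => ⟨sec c, rfl⟩
  have hcomp : ∀ g : graphExtension h L,
      (QuotientGroup.mk (sec ((g : J ⊕ I → Z2) ∘ Sum.inl)) :
        graphExtension h L ⧸ (graphExtensionIncl h L).range) = QuotientGroup.mk g := by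
    intro g
    rw [QuotientGroup.eq, mem_range_graphExtensionIncl]
    funext j
    simp [sec]
  have hcont : Continuous fun c => (QuotientGroup.mk (sec c) :
      graphExtension h L ⧸ (graphExtensionIncl h L).range) := by
    rw [hq.continuous_iff]
    refine Continuous.congr QuotientGroup.continuous_mk fun g => (hcomp g).symm
  refine Function.Surjective.compactSpace hcont fun y => ?_
  obtain ⟨g, rfl⟩ := QuotientGroup.mk_surjective y
  exact ⟨_, hcomp g⟩

/-- Otherwise some sequence in `K` has independent J-parts and a cluster point `g`. At the
coordinate supplied by `hwild` the L-parts vanish, so the coordinate of each point is that of `h`,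
and it separates `g` from a whole tail. -/
theorem finite_image_inl_of_isCompact
    (hwild : ∀ s : ℕ → (J → Z2) × L,
      LinearIndependent (ZMod 2)
        (fun n => (toVec (s (n + 1)).1).toAdd - (toVec (s 0).1).toAdd) →
      ∃ i, (∀ n, ((s n).2 : I → Z2) i = 1) ∧ ∀ n, h (s (n + 1)).1 i ≠ h (s 0).1 i)
    {K : Set (graphExtension h L)} (hK : IsCompact K) :
    ((fun g : graphExtension h L => (g : J ⊕ I → Z2) ∘ Sum.inl) '' K).Finite := by
  by_contra hinf
  let π : graphExtension h L → (J → Z2) := fun g => (g : J ⊕ I → Z2) ∘ Sum.inl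
  let lpart : graphExtension h L → L := fun g => ⟨_, mem_graphExtension.1 g.2⟩
  have hinj : Function.Injective fun x : J → Z2 => (toVec x).toAdd := fun x y hxy => hxy
  obtain ⟨u, hu, huK⟩ := (Set.Infinite.image hinj.injOn hinf).exists_linearIndependent_seq
    (K := ZMod 2)
  have hk : ∀ n, ∃ k ∈ K, (toVec (π k)).toAdd = u n := by
    intro n
    obtain ⟨_, ⟨k, hk, rfl⟩, hkn⟩ := huK n
    exact ⟨k, hk, hkn⟩
  choose k hkK hku using hk
  obtain ⟨g, -, hg⟩ := hK.exists_mapClusterPt (f := atTop) (u := k)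
    (tendsto_principal.2 (Eventually.of_forall hkK))
  obtain ⟨m, hm⟩ := hu.exists_tail_sub (toVec (π g)).toAdd
  -- Term 0 carries the cluster point; the later terms are the tail whose differences from it are
  -- independent.
  let s : ℕ → (J → Z2) × L := fun n =>
    n.casesOn (π g, lpart g) fun n => (π (k (n + m)), lpart (k (n + m)))
  simp only [← hku] at hm
  obtain ⟨i, hi1, hi⟩ := hwild s hm
  have hval : ∀ x : graphExtension h L, (lpart x : I → Z2) i = 1 →
      (x : J ⊕ I → Z2) (Sum.inr i) = h (π x) i := fun x hx => div_eq_one.1 hx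
  have hopen : IsOpen {x : graphExtension h L |
      (x : J ⊕ I → Z2) (Sum.inr i) = (g : J ⊕ I → Z2) (Sum.inr i)} :=
    (isOpen_discrete {(g : J ⊕ I → Z2) (Sum.inr i)}).preimage
      (f := fun x : graphExtension h L => (x : J ⊕ I → Z2) (Sum.inr i))
      ((continuous_apply (Sum.inr i)).comp continuous_subtype_val)
  obtain ⟨n, hmn, hn⟩ := frequently_atTop.1 (hg.frequently (hopen.mem_nhds rfl)) m
  obtain ⟨n, rfl⟩ := Nat.exists_eq_add_of_le' hmn
  refine hi n ?_
  have h1 := hval _ (hi1 (n + 1))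
  have h0 := hval _ (hi1 0)
  change h (π (k (n + m))) i = h (π g) i
  rw [← h1, ← h0]
  exact hn

end extension
-- The main theorem.
theorem mainTheorem8 (κ : Cardinal.{u}) (hκ : Cardinal.aleph0 ≤ κ)
    (J : Type u) (hJ : Cardinal.mk J = κ)
    (I : Type u) (hI : Cardinal.mk I = 2 ^ κ)
    (L : Subgroup (I → Z2))
    (hLdense : Dense (L : Set (I → Z2)))
    (hLpseudo : IsPseudocompact L)
    (hLcard : Cardinal.mk L ≤ 2 ^ κ)
    (hLdual : DiscreteTopology (PontryaginDual L))
    (hLSm : ConditionSm κ L) :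
    ∃ (G : Type u) (_ : CommGroup G) (_ : TopologicalSpace G) (_ : IsTopologicalGroup G)
      (_ : T2Space G) (i : L →* G),
      IsPseudocompact G ∧
      Topology.IsClosedEmbedding i ∧
      CompactSpace (G ⧸ i.range) ∧
      Nonempty (PontryaginDual G ≃ₜ*
        (Bohr (Multiplicative (J →₀ ZMod 2)) × PontryaginDual L)) := by
  have hL : CountablyDense (L : Set (I → Z2)) := .of_isPseudocompact hLdense hLpseudo
  obtain ⟨h, hh⟩ := exists_wild_hom hκ hJ hLcard hLSm
  have hG : CountablyDense (graphExtension h L : Set (J ⊕ I → Z2)) :=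
    countablyDense_graphExtension hL
  refine ⟨graphExtension h L, inferInstance, inferInstance, inferInstance, inferInstance,
    graphExtensionIncl h L, hG.isPseudocompact, isClosedEmbedding_graphExtensionIncl,
    compactSpace_quotient_graphExtension hL, ?_⟩
  exact nonempty_dual_continuousMulEquiv hL hG
    ⟨graphExtensionIncl h L, continuous_graphExtensionIncl⟩ (fun _ => rfl)
    (fun c => ⟨⟨Sum.elim c (1 * h c), elim_mem_graphExtension c L.one_mem⟩, rfl⟩)
    (fun K hK => finite_image_inl_of_isCompact hh hK)
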